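/- A DL-Lite$_{\text{core}}$ ontology is a finite set of inclusions $B_1\sqsubseteq B_2$ and $B_1\sqsubseteq\neg B_2$ between basic concepts (a basic concept is a concept name $A$, or $\exists P$ or $\exists P^{-1}$ for a role name $P$), together with a finite set of assertions $A(a)$, $P(a,b)$ about constants. A union of Boolean conjunctive queries (UCQ) with inequalities is a finite disjunction of existentially closed conjunctions of atoms $A(x)$, $P(x,y)$ and $x\neq y$, where $x,y$ are variables. An ontology $\mathcal O$ entails $\Psi$, written $\mathcal O\models\Psi$, if $\Psi$ is true in every model of $\mathcal O$; under the Unique Name Assumption only those models are considered in which different constants mentioned in $\mathcal O$ are interpreted as different elements. Theorem. The problem "given a DL-Lite$_{\text{core}}$ ontology $\mathcal O$ and a UCQ with inequalities $\Psi$, does $\mathcal O\models\Psi$?" is undecidable, both with and without the Unique Name Assumption. Moreover, let $\mathbb T=[l,r,\Pi]$ be any instance of the word problem for Thue systems: $\Pi=\{[l_1,r_1],\dots,[l_n,r_n]\}$, where $l,r$ and all $l_k,r_k$ are nonempty words over a finite alphabet $\mathfrak A$. Let $\simeq_\Pi$ be the smallest equivalence relation on $\mathfrak A^*$ with $wl_kv\simeq_\Pi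 wr_kv$ for all $w,v\in\mathfrak A^*$ and all $k$. Regard the letters of $\mathfrak A$ as role names, let $T\notin\mathfrak A$ be another role name, $A$ a concept name and $a$ a constant. Let $\mathcal O_{\mathbb T}$ consist of $A(a)$, $T(a,a)$, of $A\sqsubseteq\exists R$ for $R\in\mathfrak A$, and of $\exists S^{-1}\sqsubseteq\exists R$ for $R,S\in\mathfrak A$. Write $x\xrightarrow{w}y$ for the conjunctive query saying that there is a path from $x$ to $y$ labelled with the word $w$, and let $$\Psi_{\mathbb T}\;=\;\bigvee_{k=1}^{n}\exists x,y,y'\,\bigl(y\neq y'\wedge x\xrightarrow{l_k}y\wedge x\xrightarrow{r_k}y'\bigr)\;\vee\;\exists x,y\,\bigl(A(x)\wedge x\xrightarrow{l}y\wedge x\xrightarrow{r}y\bigr).$$ Then $\mathcal O_{\mathbb T}\models\Psi_{\mathbb T}$ if and only if $l\simeq_\Pi r$, both with and without the Unique Name Assumption. Let $\mathbb D$ be the structure with universe $\mathfrak A^*/{\simeq_\Pi}$ in which $R([w],[v])$ holds iff $wR\simeq_\Pi v$ (for $R\in\mathfrak A$), $A([w])$ holds iff $w\simeq_\Pi\varepsilon$,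 $T([\varepsilon],s)$ holds for all $s$ (and no other atoms hold), and every constant, in particular $a$, is interpreted as $[\varepsilon]$. Then $\mathbb D$ is a model of $\mathcal O_{\mathbb T}$ and respects the Unique Name Assumption for $\mathcal O_{\mathbb T}$, and if $l\not\simeq_\Pi r$ then $\Psi_{\mathbb T}$ is false in $\mathbb D$. -/

import Mathlib

/-! ### Syntax of DL-Lite_core

Concept names, role names, individual names and query variables are natural numbers. -/

namespace DLLite

/-- Roles: `P` or `P⁻`, for a role name `P`. -/
inductive Role : Type
  | name (P : ℕ)
  | inv (P : ℕ)

/-- Basic concepts: a concept name `A`, or `∃R` for a role `R`. -/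
inductive BasicConcept : Type
  | atom (A : ℕ)
  | ex (R : Role)

/-- TBox axioms of DL-Lite_core: `B₁ ⊑ B₂` and `B₁ ⊑ ¬B₂`, for basic concepts `B₁`, `B₂`. -/
inductive Inclusion : Type
  | sub (B₁ B₂ : BasicConcept)
  | subNot (B₁ B₂ : BasicConcept)

/-- ABox assertions: `A(a)` and `P(a, b)`, for individual names `a`, `b`. -/
inductive Assertion : Type
  | concept (A a : ℕ)
  | role (P a b : ℕ)

/-- A DL-Lite_core ontology: a finite set of TBox axioms and a finite set of ABox assertions. -/
structure Ontology : Type where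
  tbox : List Inclusion
  abox : List Assertion

/-- Atoms of a conjunctive query with inequalities: `A(x)`, `P(x, y)` and `x ≠ y`,
for variables `x`, `y`. -/
inductive Atom : Type
  | concept (A x : ℕ)
  | role (P x y : ℕ)
  | neq (x y : ℕ)

/-- Boolean conjunctive queries with inequalities: the existential closure of the
conjunction of the listed atoms. -/
abbrev CQ : Type := List Atom

/-- Unions of Boolean conjunctive queries with inequalities. -/
abbrev UCQ : Type := List CQ

/-! ### Inputs as finite data: the evident encodings -/

def Role.equivSum : Role ≃ ℕ ⊕ ℕ where
  toFun
    | .name P => .inl P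
    | .inv P => .inr P
  invFun
    | .inl P => .name P
    | .inr P => .inv P
  left_inv := by rintro (_ | _) <;> rfl
  right_inv := by rintro (_ | _) <;> rfl

instance : Primcodable Role := Primcodable.ofEquiv _ Role.equivSum

def BasicConcept.equivSum : BasicConcept ≃ ℕ ⊕ Role where
  toFun
    | .atom A => .inl A
    | .ex R => .inr R
  invFun
    | .inl A => .atom A
    | .inr R => .ex R
  left_inv := by rintro (_ | _) <;> rfl
  right_inv := by rintro (_ | _) <;> rfl

instance : Primcodable BasicConcept := Primcodable.ofEquiv _ BasicConcept.equivSum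

def Inclusion.equivSum :
    Inclusion ≃ (BasicConcept × BasicConcept) ⊕ (BasicConcept × BasicConcept) where
  toFun
    | .sub B₁ B₂ => .inl (B₁, B₂)
    | .subNot B₁ B₂ => .inr (B₁, B₂)
  invFun
    | .inl p => .sub p.1 p.2
    | .inr p => .subNot p.1 p.2
  left_inv := by rintro (_ | _) <;> rfl
  right_inv := by rintro (_ | _) <;> rfl

instance : Primcodable Inclusion := Primcodable.ofEquiv _ Inclusion.equivSum

def Assertion.equivSum : Assertion ≃ (ℕ × ℕ) ⊕ (ℕ × ℕ × ℕ) where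
  toFun
    | .concept A a => .inl (A, a)
    | .role P a b => .inr (P, a, b)
  invFun
    | .inl p => .concept p.1 p.2
    | .inr p => .role p.1 p.2.1 p.2.2
  left_inv := by rintro (_ | _) <;> rfl
  right_inv := by rintro (_ | _) <;> rfl

instance : Primcodable Assertion := Primcodable.ofEquiv _ Assertion.equivSum

def Ontology.equivProd : Ontology ≃ List Inclusion × List Assertion where
  toFun O := (O.tbox, O.abox)
  invFun p := ⟨p.1, p.2⟩
  left_inv _ := rfl
  right_inv _ := rfl

instance : Primcodable Ontology := Primcodable.ofEquiv _ Ontology.equivProd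

def Atom.equivSum : Atom ≃ (ℕ × ℕ) ⊕ ((ℕ × ℕ × ℕ) ⊕ (ℕ × ℕ)) where
  toFun
    | .concept A x => .inl (A, x)
    | .role P x y => .inr (.inl (P, x, y))
    | .neq x y => .inr (.inr (x, y))
  invFun
    | .inl p => .concept p.1 p.2
    | .inr (.inl p) => .role p.1 p.2.1 p.2.2
    | .inr (.inr p) => .neq p.1 p.2
  left_inv := by rintro (_ | _ | _) <;> rfl
  right_inv := by rintro (_ | _ | _) <;> rfl

instance : Primcodable Atom := Primcodable.ofEquiv _ Atom.equivSum

/-! ### Semantics -/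

/-- A structure: a set of vertices (nonempty, because of `ind`) with interpretations of the
concept names, role names and individual names. -/
structure Interpretation : Type 1 where
  dom : Type
  con : ℕ → dom → Prop
  rol : ℕ → dom → dom → Prop
  ind : ℕ → dom

namespace Interpretation

variable (D : Interpretation)

def roleHolds : Role → D.dom → D.dom → Prop
  | .name P, s, t => D.rol P s t
  | .inv P, s, t => D.rol P t s

def conceptHolds : BasicConcept → D.dom → Prop
  | .atom A, s => D.con A s
  | .ex R, s => ∃ t, D.roleHolds R s t

def satInclusion : Inclusion → Prop
  | .sub B₁ B₂ => ∀ s, D.conceptHolds B₁ s → D.conceptHolds B₂ s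
  | .subNot B₁ B₂ => ∀ s, D.conceptHolds B₁ s → ¬ D.conceptHolds B₂ s

def satAssertion : Assertion → Prop
  | .concept A a => D.con A (D.ind a)
  | .role P a b => D.rol P (D.ind a) (D.ind b)

/-- `D` is a model of the ontology `O` (no Unique Name Assumption). -/
def IsModel (O : Ontology) : Prop :=
  (∀ i ∈ O.tbox, D.satInclusion i) ∧ (∀ c ∈ O.abox, D.satAssertion c)

def satAtom (v : ℕ → D.dom) : Atom → Prop
  | .concept A x => D.con A (v x)
  | .role P x y => D.rol P (v x) (v y)
  | .neq x y => v x ≠ v y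

/-- Truth of a Boolean conjunctive query with inequalities in `D`. -/
def satCQ (q : CQ) : Prop :=
  ∃ v : ℕ → D.dom, ∀ c ∈ q, D.satAtom v c

/-- Truth of a union of Boolean conjunctive queries with inequalities in `D`. -/
def satUCQ (Q : UCQ) : Prop :=
  ∃ q ∈ Q, D.satCQ q

end Interpretation

/-- The individual names (constants) that occur in an assertion. -/
def Assertion.individuals : Assertion → Set ℕ
  | .concept _ a => {a}
  | .role _ a b => {a, b}

/-- The individual names (constants) mentioned in an ontology. -/
def Ontology.individuals (O : Ontology) : Set ℕ :=
  {a | ∃ c ∈ O.abox, a ∈ c.individuals}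

/-- The Unique Name Assumption: different constants mentioned in `O` are interpreted in `D`
as different vertices. -/
def Interpretation.UniqueNames (D : Interpretation) (O : Ontology) : Prop :=
  Set.InjOn D.ind O.individuals

/-- `O ⊨ Q`, without the Unique Name Assumption. -/
def Entails (O : Ontology) (Q : UCQ) : Prop :=
  ∀ D : Interpretation, D.IsModel O → D.satUCQ Q

/-- `O ⊨ Q`, under the Unique Name Assumption. -/
def EntailsUNA (O : Ontology) (Q : UCQ) : Prop :=
  ∀ D : Interpretation, D.IsModel O → D.UniqueNames O → D.satUCQ Q

/-! ### Thue systems -/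

/-- An instance `[l, r, Π]` of the word problem for Thue systems, over the alphabet
`{0, …, m - 1}`, with all words nonempty. -/
structure ThueInstance : Type where
  m : ℕ
  l : List (Fin m)
  r : List (Fin m)
  rules : List (List (Fin m) × List (Fin m))
  l_ne : l ≠ []
  r_ne : r ≠ []
  rules_ne : ∀ p ∈ rules, p.1 ≠ [] ∧ p.2 ≠ []

namespace ThueInstance

variable (T : ThueInstance)

/-- The pairs `(w lₖ v, w rₖ v)`. -/
def Step (u u' : List (Fin T.m)) : Prop :=
  ∃ p ∈ T.rules, ∃ w v, u = w ++ p.1 ++ v ∧ u' = w ++ p.2 ++ v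

/-- The smallest equivalence relation `≃_Π` on words that contains all pairs of `Step`. -/
def wordSetoid : Setoid (List (Fin T.m)) := Relation.EqvGen.setoid T.Step

/-- The instance is positive: `l ≃_Π r`. -/
def Positive : Prop := T.wordSetoid.r T.l T.r

/-! The letters are the role names `0, …, m - 1`; the additional role name `T` is `m`, the
concept name `A` is `0` and the constant `a` is `0`. -/

/-- The ontology `A(a)`, `T(a, a)`, `A ⊑ ∃R` and `∃S⁻ ⊑ ∃R` for all letters `R`, `S`. -/
def ontology : Ontology where
  tbox :=
    ((List.range T.m).map fun R => .sub (.atom 0) (.ex (.name R))) ++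
    ((List.range T.m).flatMap fun S => (List.range T.m).map fun R =>
      .sub (.ex (.inv S)) (.ex (.name R)))
  abox := [.concept 0 0, .role T.m 0 0]

/-- The conjunctive query saying that there is a path from `x` to `y` labelled by a nonempty
word; the intermediate variables are `z`, `z + 1`, `z + 2`, …. -/
def path {m : ℕ} (x y z : ℕ) : List (Fin m) → CQ
  | [] => []
  | [R] => [.role R x y]
  | R :: S :: w => .role R x z :: path z y (z + 1) (S :: w)

/-- For a pair `p = [lₖ, rₖ]`, the existential closure of `γₖ`:
`y ≠ y' ∧ (x —lₖ→ y) ∧ (x —rₖ→ y')`, where `x`, `y`, `y'` are the variables `0`, `1`, `2`. -/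
def detector {m : ℕ} (p : List (Fin m) × List (Fin m)) : CQ :=
  .neq 1 2 :: (path 0 1 3 p.1 ++ path 0 2 (3 + p.1.length) p.2)

/-- The existential closure of the diamond query `A(x) ∧ (x —l→ y) ∧ (x —r→ y)`, where `x`, `y`
are the variables `0`, `1`. -/
def diamond : CQ :=
  .concept 0 0 :: (path 0 1 2 T.l ++ path 0 1 (2 + T.l.length) T.r)

/-- The union of all the detectors and of the diamond query. -/
def query : UCQ := T.rules.map detector ++ [T.diamond]

/-- The canonical structure on the quotient of the set of words by `≃_Π`: there is an `R`-edge
from `[w]` to `[v]` iff `wR ≃_Π v`; `A([w])` iff `w ≃_Π ε`; `T([ε], s)` for every vertex `s`;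
`a` is interpreted as `[ε]`. -/
def canonical : Interpretation where
  dom := Quotient T.wordSetoid
  con A s := A = 0 ∧ s = Quotient.mk T.wordSetoid []
  rol P s t :=
    (∃ R : Fin T.m, P = R ∧ ∃ w v, s = Quotient.mk T.wordSetoid w ∧
      t = Quotient.mk T.wordSetoid v ∧ T.wordSetoid.r (w ++ [R]) v) ∨
    (P = T.m ∧ s = Quotient.mk T.wordSetoid [])
  ind _ := Quotient.mk T.wordSetoid []

end ThueInstance

end DLLite

/-! Failure of all detectors in a model says that an `lₖ`-path and an `rₖ`-path from the same vertex
end at the same vertex. The inclusions provide paths with every label from `a`, so replacing `lₖ` by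
`rₖ` inside a word does not change the set of endpoints of the paths from `a` labelled with it. If
`l ≃_Π r`, some vertex thus ends both an `l`-path and an `r`-path from `a`, and the diamond query
holds (`entails_of_positive`). Conversely, in the canonical structure letters act by right
multiplication, so no detector fires and the diamond query would give `l ≃_Π r`
(`canonical_not_satUCQ`). This structure respects unique names, so one countermodel serves both
semantics.

For undecidability, halting of a Turing machine is reduced to the word problem. The rules simulate
the machine on words for configurations and collapse every halting configuration to one word.
Equivalence may also use rules backwards; soundness therefore comes from an invariant: the letters
act on a set so that both sides of each rule act alike and the value of a configuration word records
whether the machine halts (`Rule.foldr_act_eq`). A single machine with unary input, encoding the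
halting problem for codes, gives a fixed system in which only `l` varies, and the resulting query is
computed primitive recursively. -/

namespace DLLite

/-! ### Truth of the query in terms of labelled paths -/

namespace Interpretation

variable (D : Interpretation)

/-- There is a path from `s` to `t` whose edges are labelled with the letters of the word `w`. -/
def HasPath {m : ℕ} : List (Fin m) → D.dom → D.dom → Prop
  | [], s, t => s = t
  | R :: w, s, t => ∃ u, D.rol R s u ∧ HasPath w u t

variable {D}

theorem hasPath_append {m : ℕ} {w w' : List (Fin m)} {s t : D.dom} :
    D.HasPath (w ++ w') s t ↔ ∃ u, D.HasPath w s u ∧ D.HasPath w' u t := by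
  induction w generalizing s with
  | nil => simp [HasPath]
  | cons R w ih =>
    simp only [List.cons_append, HasPath, ih]
    constructor
    · rintro ⟨x, h, u, h1, h2⟩
      exact ⟨u, ⟨x, h, h1⟩, h2⟩
    · rintro ⟨u, ⟨x, h, h1⟩, h2⟩
      exact ⟨x, h, u, h1, h2⟩

theorem hasPath_of_satAtom_path {m : ℕ} {w : List (Fin m)} (hw : w ≠ []) {v : ℕ → D.dom}
    {x y z : ℕ} (h : ∀ c ∈ ThueInstance.path x y z w, D.satAtom v c) :
    D.HasPath w (v x) (v y) := by
  induction w generalizing x z with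
  | nil => exact absurd rfl hw
  | cons R w ih =>
    cases w with
    | nil => exact ⟨v y, h (.role R x y) (by simp [ThueInstance.path]), rfl⟩
    | cons S w =>
      exact ⟨v z, h (.role R x z) (by simp [ThueInstance.path]),
        ih (by simp) fun c hc => h c (List.mem_cons_of_mem _ hc)⟩

/-- A path is witnessed by an assignment that changes only variables from `z` on, and whose
values from `z + w.length` on do not matter. -/
theorem exists_satAtom_path {m : ℕ} {w : List (Fin m)} {v : ℕ → D.dom} {x y z : ℕ}
    (hx : x < z) (hy : y < z) (h : D.HasPath w (v x) (v y)) :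
    ∃ v' : ℕ → D.dom, (∀ i < z, v' i = v i) ∧
      ∀ v'' : ℕ → D.dom, (∀ i < z + w.length, v'' i = v' i) →
        ∀ c ∈ ThueInstance.path x y z w, D.satAtom v'' c := by
  induction w generalizing x z v with
  | nil => exact ⟨v, fun _ _ => rfl, fun _ _ c hc => by simp [ThueInstance.path] at hc⟩
  | cons R w ih =>
    cases w with
    | nil =>
      obtain ⟨u, hu, rfl⟩ := h
      refine ⟨v, fun _ _ => rfl, fun v'' hv c hc => ?_⟩
      simp only [ThueInstance.path, List.mem_singleton] at hc
      subst hc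
      simpa [satAtom, hv x (by omega), hv y (by omega)] using hu
    | cons S w =>
      obtain ⟨u, hu, hp⟩ := h
      obtain ⟨v', h1, h2⟩ := ih (v := Function.update v z u) (x := z) (z := z + 1)
        (by omega) (by omega) (by simpa [Function.update_of_ne hy.ne] using hp)
      have h1' : ∀ i < z, v' i = v i := fun i hi => by
        rw [h1 i (by omega), Function.update_of_ne hi.ne]
      refine ⟨v', h1', fun v'' hv c hc => ?_⟩
      simp only [ThueInstance.path, List.mem_cons] at hc
      rcases hc with rfl | hc
      · have hz : v' z = u := by rw [h1 z (by omega), Function.update_self]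
        simpa [satAtom, hv x (by simp; omega), hv z (by simp), h1' x hx, hz] using hu
      · exact h2 v'' (fun i hi => hv i (by simp at hi ⊢; omega)) c hc

/-- The fresh variables of the second path start where those of the first stop, so choosing them
cannot spoil the first path. -/
theorem exists_satAtom_path_append {m : ℕ} {w w' : List (Fin m)} {v : ℕ → D.dom}
    {x y y' z : ℕ} (hx : x < z) (hy : y < z) (hy' : y' < z)
    (h : D.HasPath w (v x) (v y)) (h' : D.HasPath w' (v x) (v y')) :
    ∃ v' : ℕ → D.dom, (∀ i < z, v' i = v i) ∧
      ∀ c ∈ ThueInstance.path x y z w ++ ThueInstance.path x y' (z + w.length) w',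
        D.satAtom v' c := by
  obtain ⟨v₁, h1, h2⟩ := exists_satAtom_path hx hy h
  obtain ⟨v₂, h3, h4⟩ := exists_satAtom_path (v := v₁) (w := w') (x := x) (y := y')
    (z := z + w.length) (by omega) (by omega) (by rwa [h1 x hx, h1 y' hy'])
  refine ⟨v₂, fun i hi => by rw [h3 i (by omega), h1 i hi], fun c hc => ?_⟩
  rcases List.mem_append.1 hc with hc | hc
  · exact h2 v₂ h3 c hc
  · exact h4 v₂ (fun _ _ => rfl) c hc

theorem satCQ_detector {m : ℕ} {p : List (Fin m) × List (Fin m)} (h1 : p.1 ≠ [])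
    (h2 : p.2 ≠ []) :
    D.satCQ (ThueInstance.detector p) ↔
      ∃ x y y', y ≠ y' ∧ D.HasPath p.1 x y ∧ D.HasPath p.2 x y' := by
  constructor
  · rintro ⟨v, hv⟩
    simp only [ThueInstance.detector, List.forall_mem_cons, List.forall_mem_append] at hv
    exact ⟨v 0, v 1, v 2, hv.1, hasPath_of_satAtom_path h1 hv.2.1,
      hasPath_of_satAtom_path h2 hv.2.2⟩
  · rintro ⟨x, y, y', hne, hy, hy'⟩
    let v : ℕ → D.dom := fun i => if i = 0 then x else if i = 1 then y else y'
    obtain ⟨v', hv, hs⟩ := exists_satAtom_path_append (v := v) (x := 0) (y := 1) (y' := 2)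
      (z := 3) (by omega) (by omega) (by omega) hy hy'
    refine ⟨v', ?_⟩
    simp only [ThueInstance.detector, List.forall_mem_cons]
    refine ⟨?_, hs⟩
    simpa [satAtom, hv 1 (by omega), hv 2 (by omega), v] using hne

theorem satCQ_diamond {T : ThueInstance} :
    D.satCQ T.diamond ↔ ∃ x y, D.con 0 x ∧ D.HasPath T.l x y ∧ D.HasPath T.r x y := by
  constructor
  · rintro ⟨v, hv⟩
    simp only [ThueInstance.diamond, List.forall_mem_cons, List.forall_mem_append] at hv
    exact ⟨v 0, v 1, hv.1, hasPath_of_satAtom_path T.l_ne hv.2.1,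
      hasPath_of_satAtom_path T.r_ne hv.2.2⟩
  · rintro ⟨x, y, hx, hy, hy'⟩
    let v : ℕ → D.dom := fun i => if i = 0 then x else y
    obtain ⟨v', hv, hs⟩ := exists_satAtom_path_append (v := v) (x := 0) (y := 1) (y' := 1)
      (z := 2) (by omega) (by omega) (by omega) hy hy'
    refine ⟨v', ?_⟩
    simp only [ThueInstance.diamond, List.forall_mem_cons]
    refine ⟨?_, hs⟩
    simpa [satAtom, hv 0 (by omega), v] using hx

theorem satUCQ_query {T : ThueInstance} :
    D.satUCQ T.query ↔
      (∃ p ∈ T.rules, ∃ x y y', y ≠ y' ∧ D.HasPath p.1 x y ∧ D.HasPath p.2 x y') ∨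
        ∃ x y, D.con 0 x ∧ D.HasPath T.l x y ∧ D.HasPath T.r x y := by
  rw [← satCQ_diamond]
  simp only [satUCQ, ThueInstance.query, List.mem_append, List.mem_map, List.mem_singleton,
    or_and_right, exists_or, exists_eq_left, exists_exists_and_eq_and]
  refine or_congr_left (exists_congr fun p => and_congr_right fun hp => ?_)
  exact satCQ_detector (T.rules_ne p hp).1 (T.rules_ne p hp).2

end Interpretation

/-! ### Correctness of the reduction from Thue systems -/

namespace ThueInstance

open Interpretation

variable (T : ThueInstance)

theorem isModel_ontology {D : Interpretation} :
    D.IsModel T.ontology ↔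
      (∀ s, D.con 0 s → ∀ R : Fin T.m, ∃ t, D.rol R s t) ∧
      (∀ (S : Fin T.m) (s t : D.dom), D.rol S s t → ∀ R : Fin T.m, ∃ u, D.rol R t u) ∧
      D.con 0 (D.ind 0) ∧ D.rol T.m (D.ind 0) (D.ind 0) := by
  simp only [IsModel, ontology, List.mem_append, List.mem_map, List.mem_flatMap, List.mem_range]
  constructor
  · rintro ⟨h1, h2⟩
    refine ⟨fun s hs R => h1 _ (Or.inl ⟨R, R.2, rfl⟩) s hs, fun S s t hst R =>
      h1 _ (Or.inr ⟨S, S.2, R, R.2, rfl⟩) t ⟨s, hst⟩, h2 (.concept 0 0) (by simp),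
      h2 (.role T.m 0 0) (by simp)⟩
  · rintro ⟨h1, h2, h3, h4⟩
    constructor
    · rintro i (⟨R, hR, rfl⟩ | ⟨S, hS, R, hR, rfl⟩)
      · exact fun s hs => h1 s hs ⟨R, hR⟩
      · rintro t ⟨s, hst⟩
        exact h2 ⟨S, hS⟩ s t hst ⟨R, hR⟩
    · simp only [List.forall_mem_cons]
      exact ⟨h3, h4, by simp⟩

/-- This makes right multiplication by a letter well defined on classes, hence the letters
deterministic in the canonical structure. -/
theorem wordSetoid_append {u u' : List (Fin T.m)} (h : T.wordSetoid.r u u')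
    (v : List (Fin T.m)) : T.wordSetoid.r (u ++ v) (u' ++ v) := by
  change Relation.EqvGen T.Step _ _ at *
  induction h with
  | rel _ _ h =>
    obtain ⟨p, hp, w, v', rfl, rfl⟩ := h
    exact .rel _ _ ⟨p, hp, w, v' ++ v, by simp, by simp⟩
  | refl _ => exact .refl _
  | symm _ _ _ ih => exact .symm _ _ ih
  | trans _ _ _ _ _ ih1 ih2 => exact .trans _ _ _ ih1 ih2

theorem hasPath_canonical {w u : List (Fin T.m)} {t : T.canonical.dom} :
    T.canonical.HasPath w (Quotient.mk T.wordSetoid u) t ↔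
      t = Quotient.mk T.wordSetoid (u ++ w) := by
  induction w generalizing u with
  | nil => simp only [HasPath, List.append_nil]; exact eq_comm
  | cons R w ih =>
    have key : ∀ x : T.canonical.dom, T.canonical.rol R (Quotient.mk T.wordSetoid u) x ↔
        x = Quotient.mk T.wordSetoid (u ++ [R]) := by
      intro x
      constructor
      · rintro (⟨R', hR, w', v, hw, rfl, hr⟩ | ⟨hR, _⟩)
        · obtain rfl := Fin.ext hR
          exact Quotient.sound
            (T.wordSetoid.symm (T.wordSetoid.trans (T.wordSetoid_append (Quotient.exact hw) _) hr))
        -- The extra edges out of `[ε]` carry the role name `m`, which is not a letter.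
        · exact absurd hR R.2.ne
      · rintro rfl
        exact Or.inl ⟨R, rfl, u, u ++ [R], rfl, rfl, T.wordSetoid.refl _⟩
    rw [List.append_cons, ← ih]
    constructor
    · rintro ⟨x, hx, hp⟩
      rwa [(key x).1 hx] at hp
    · exact fun hp => ⟨_, (key _).2 rfl, hp⟩

theorem canonical_isModel : T.canonical.IsModel T.ontology := by
  have h : ∀ (s : T.canonical.dom) (R : Fin T.m), ∃ t, T.canonical.rol R s t := by
    intro s R
    obtain ⟨w, rfl⟩ := Quotient.exists_rep s
    exact ⟨Quotient.mk T.wordSetoid (w ++ [R]),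
      Or.inl ⟨R, rfl, w, w ++ [R], rfl, rfl, T.wordSetoid.refl _⟩⟩
  exact T.isModel_ontology.2
    ⟨fun s _ => h s, fun _ _ t _ => h t, ⟨rfl, rfl⟩, Or.inr ⟨rfl, rfl⟩⟩

theorem canonical_uniqueNames : T.canonical.UniqueNames T.ontology := by
  have h : ∀ a ∈ T.ontology.individuals, a = 0 := by
    rintro a ⟨c, hc, ha⟩
    simp only [ontology, List.mem_cons, List.not_mem_nil, or_false] at hc
    rcases hc with rfl | rfl <;> simpa [Assertion.individuals] using ha
  intro a ha b hb _
  rw [h a ha, h b hb]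

/-- From `[u]` the two paths of a detector end at `[u lₖ] = [u rₖ]`; those of the diamond start at
`[ε]` and end at `[l]` and `[r]`. -/
theorem canonical_not_satUCQ (h : ¬ T.Positive) : ¬ T.canonical.satUCQ T.query := by
  rw [satUCQ_query]
  rintro (⟨p, hp, x, y, y', hne, hy, hy'⟩ | ⟨x, y, hx, hy, hy'⟩)
  · obtain ⟨u, rfl⟩ := Quotient.exists_rep x
    rw [hasPath_canonical] at hy hy'
    refine hne (hy.trans (Eq.trans (Quotient.sound ?_) hy'.symm))
    exact .rel _ _ ⟨p, hp, u, [], by simp, by simp⟩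
  · obtain ⟨_, rfl⟩ := hx
    rw [hasPath_canonical] at hy hy'
    exact h (Quotient.exact (s := T.wordSetoid) (hy.symm.trans hy'))

theorem entails_of_positive (h : T.Positive) : Entails T.ontology T.query := by
  intro D hD
  obtain ⟨hA, hS, ha, -⟩ := T.isModel_ontology.1 hD
  rw [satUCQ_query]
  by_contra hq
  push Not at hq
  obtain ⟨hdet, hdia⟩ := hq
  -- The inclusions yield successors only at vertices in `A` or entered by a letter, so this
  -- property is carried along paths from `a`.
  let Serial : D.dom → Prop := fun s => ∀ R : Fin T.m, ∃ t, D.rol R s t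
  have serial_of_hasPath : ∀ (w : List (Fin T.m)) s t, Serial s → D.HasPath w s t → Serial t := by
    intro w
    induction w with
    | nil => rintro s _ hs rfl; exact hs
    | cons R w ih => rintro s t hs ⟨u, hu, hp⟩; exact ih u t (hS R s u hu) hp
  have exists_path : ∀ (w : List (Fin T.m)) s, Serial s → ∃ t, D.HasPath w s t := by
    intro w
    induction w with
    | nil => exact fun s _ => ⟨s, rfl⟩
    | cons R w ih =>
      intro s hs
      obtain ⟨u, hu⟩ := hs R
      obtain ⟨t, ht⟩ := ih u (hS R s u hu)
      exact ⟨t, u, hu, ht⟩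
  have ha' : Serial (D.ind 0) := hA _ ha
  -- Some path exists for the other side of the rule, and since no detector fires it must end at the
  -- same `t`.
  have rule_iff : ∀ p ∈ T.rules, ∀ s t, Serial s → (D.HasPath p.1 s t ↔ D.HasPath p.2 s t) := by
    intro p hp s t hs
    constructor <;> intro ht
    · obtain ⟨t', ht'⟩ := exists_path p.2 s hs
      by_contra hn
      exact hdet p hp s t t' (fun e => hn (e ▸ ht')) ht ht'
    · obtain ⟨t', ht'⟩ := exists_path p.1 s hs
      by_contra hn
      exact hdet p hp s t' t (fun e => hn (e ▸ ht')) ht' ht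
  -- Only the sets of endpoints are compared; single letters need not be deterministic in `D`.
  have path_iff : ∀ u u', Relation.EqvGen T.Step u u' → ∀ t,
      (D.HasPath u (D.ind 0) t ↔ D.HasPath u' (D.ind 0) t) := by
    intro u u' huu
    induction huu with
    | rel _ _ h =>
      obtain ⟨p, hp, w, v, rfl, rfl⟩ := h
      intro t
      simp only [hasPath_append, ← exists_and_right, and_assoc]
      refine exists_congr fun x => exists_congr fun y => and_congr_right fun hy => ?_
      exact and_congr_left fun _ => rule_iff p hp _ _ (serial_of_hasPath w _ _ ha' hy)
    | refl _ => exact fun _ => Iff.rfl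
    | symm _ _ _ ih => exact fun t => (ih t).symm
    | trans _ _ _ _ _ ih1 ih2 => exact fun t => (ih1 t).trans (ih2 t)
  obtain ⟨t, ht⟩ := exists_path T.l _ ha'
  exact hdia _ t ha ht ((path_iff _ _ h t).1 ht)

theorem positive_of_entailsUNA (h : EntailsUNA T.ontology T.query) : T.Positive := by
  by_contra hn
  exact T.canonical_not_satUCQ hn (h _ T.canonical_isModel T.canonical_uniqueNames)

theorem entails_iff : Entails T.ontology T.query ↔ T.Positive :=
  ⟨fun h => T.positive_of_entailsUNA fun D hD _ => h D hD, T.entails_of_positive⟩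

theorem entailsUNA_iff : EntailsUNA T.ontology T.query ↔ T.Positive :=
  ⟨T.positive_of_entailsUNA, fun h D hD _ => T.entails_of_positive h D hD⟩

end ThueInstance

end DLLite

/-! ### Thue systems over arbitrary alphabets -/

section Rewriting

variable {α : Type}

/-- One rewriting step, in an arbitrary context, along a rule of `ρ`. -/
def Rewrite (ρ : List α → List α → Prop) (u u' : List α) : Prop :=
  ∃ p q, ρ p q ∧ ∃ w v, u = w ++ p ++ v ∧ u' = w ++ q ++ v

/-- The equivalence relation generated by rewriting with the rules of `ρ`. -/
abbrev ThueEquiv (ρ : List α → List α → Prop) : List α → List α → Prop :=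
  Relation.EqvGen (Rewrite ρ)

theorem ThueEquiv.of_rule {ρ : List α → List α → Prop} {p q u u' : List α} (w v : List α)
    (h : ρ p q) (hu : u = w ++ (p ++ v)) (hu' : u' = w ++ (q ++ v)) : ThueEquiv ρ u u' :=
  .rel _ _ ⟨p, q, h, w, v, by simpa using hu, by simpa using hu'⟩

/-- If the letters act on a set and both sides of each rule act in the same way, then so do
equivalent words. -/
theorem ThueEquiv.foldr_eq {ρ : List α → List α → Prop} {X : Type} {act : α → X → X}
    (hact : ∀ p q, ρ p q → ∀ x, p.foldr act x = q.foldr act x) {u u' : List α}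
    (h : ThueEquiv ρ u u') (x : X) : u.foldr act x = u'.foldr act x := by
  induction h with
  | rel _ _ h =>
    obtain ⟨p, q, hpq, w, v, rfl, rfl⟩ := h
    simp only [List.foldr_append, hact p q hpq]
  | refl _ => rfl
  | symm _ _ _ ih => exact ih.symm
  | trans _ _ _ _ _ ih1 ih2 => exact ih1.trans ih2

theorem Relation.EqvGen.map {α β : Type} {r : α → α → Prop} {s : β → β → Prop} (f : α → β)
    (hf : ∀ a b, r a b → s (f a) (f b)) {a b : α} (h : EqvGen r a b) :
    EqvGen s (f a) (f b) := by
  induction h with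
  | rel _ _ h => exact .rel _ _ (hf _ _ h)
  | refl _ => exact .refl _
  | symm _ _ _ ih => exact .symm _ _ ih
  | trans _ _ _ _ _ ih1 ih2 => exact .trans _ _ _ ih1 ih2

/-- A finite set of rules over a finite alphabet is the set of rules of Thue instances. -/
theorem exists_thueInstance_positive_iff [Finite α] {ρ : List α → List α → Prop}
    (hρ : {p : List α × List α | ρ p.1 p.2}.Finite)
    (hne : ∀ p q, ρ p q → p ≠ [] ∧ q ≠ []) :
    ∃ (m : ℕ) (e : α ≃ Fin m) (rules : List (List (Fin m) × List (Fin m)))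
      (rules_ne : ∀ p ∈ rules, p.1 ≠ [] ∧ p.2 ≠ []),
      ∀ (l r : List α) (hl : l.map e ≠ []) (hr : r.map e ≠ []),
        (DLLite.ThueInstance.mk m (l.map e) (r.map e) rules hl hr rules_ne).Positive ↔
          ThueEquiv ρ l r := by
  obtain ⟨m, ⟨e⟩⟩ := Finite.exists_equiv_fin α
  let rules := hρ.toFinset.toList.map fun p => (p.1.map e, p.2.map e)
  have hrules : ∀ p, p ∈ rules ↔ ∃ u v, ρ u v ∧ p = (u.map e, v.map e) := by
    intro p
    simp [rules, eq_comm]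
  refine ⟨m, e, rules, ?_, fun l r hl hr => ⟨fun h => ?_, fun h => ?_⟩⟩
  · intro p hp
    obtain ⟨u, v, h, rfl⟩ := (hrules p).1 hp
    simpa using hne u v h
  · have := Relation.EqvGen.map (s := Rewrite ρ) (List.map e.symm) (fun a b hab => ?_) h
    · simpa using this
    · obtain ⟨p, hp, w, v, rfl, rfl⟩ := hab
      obtain ⟨u, u', h, rfl⟩ := (hrules p).1 hp
      exact ⟨u, u', h, w.map e.symm, v.map e.symm, by simp, by simp⟩
  · refine Relation.EqvGen.map (List.map e) (fun a b hab => ?_) h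
    obtain ⟨p, q, hpq, w, v, rfl, rfl⟩ := hab
    exact ⟨(p.map e, q.map e), (hrules _).2 ⟨p, q, hpq, rfl⟩, w.map e, v.map e, by simp, by simp⟩

end Rewriting

/-! ### Turing machines as Thue systems -/

namespace TuringThue

open Turing

variable {Γ Λ : Type} [Inhabited Γ] [Inhabited Λ]

/-- The alphabet for configurations of a Turing machine whose states are in `S`. -/
inductive Letter (Γ : Type) {Λ : Type} (S : Finset Λ) : Type
  | sym (a : Γ)
  | state (q : S)
  | left
  | right
  | halted

instance [Finite Γ] (S : Finset Λ) : Finite (Letter Γ S) := by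
  let f : Letter Γ S → Γ ⊕ S ⊕ Fin 3 := fun
    | .sym a => .inl a
    | .state q => .inr (.inl q)
    | .left => .inr (.inr 0)
    | .right => .inr (.inr 1)
    | .halted => .inr (.inr 2)
  refine Finite.of_injective f ?_
  rintro (_ | _ | _ | _ | _) (_ | _ | _ | _ | _) <;> simp [f]

open Letter

/-- The rules for simulating `M`. The symbol read by the machine is the one to the right of the
state. -/
inductive Rule (M : TM0.Machine Γ Λ) (S : Finset Λ) : List (Letter Γ S) → List (Letter Γ S) → Prop
  | write (q q' : S) (a b : Γ) (h : M q a = some (q'.1, .write b)) :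
      Rule M S [state q, sym a] [state q', sym b]
  | moveRight (q q' : S) (a : Γ) (h : M q a = some (q'.1, .move .right)) :
      Rule M S [state q, sym a] [sym a, state q']
  | moveLeft (q q' : S) (a c : Γ) (h : M q a = some (q'.1, .move .left)) :
      Rule M S [sym c, state q, sym a] [state q', sym c, sym a]
  -- Used in both directions, the blank rules identify words that represent the same half tape up to
  -- blanks at its far end, as `ListBlank` does.
  | blankLeft : Rule M S [left, sym default] [left]
  | blankRight : Rule M S [sym default, right] [right]
  | halt (q : S) (a : Γ) (h : M q a = none) : Rule M S [state q, sym a] [halted]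
  | eraseLeft (a : Γ) : Rule M S [sym a, halted] [halted]
  | eraseRight (a : Γ) : Rule M S [halted, sym a] [halted]

variable {M : TM0.Machine Γ Λ} {S : Finset Λ}

theorem Rule.ne_nil {p q : List (Letter Γ S)} (h : Rule M S p q) : p ≠ [] ∧ q ≠ [] := by
  cases h <;> simp

theorem finite_rule [Finite Γ] :
    {p : List (Letter Γ S) × List (Letter Γ S) | Rule M S p.1 p.2}.Finite := by
  refine ((List.finite_length_le (Letter Γ S) 3).prod (List.finite_length_le _ 3)).subset ?_
  rintro ⟨p, q⟩ h
  change Rule M S p q at h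
  cases h <;> simp

/-- The values of the suffixes of the words for configurations. -/
inductive Suffix (Γ : Type) [Inhabited Γ] : Type
  | start
  | tape (R : ListBlank Γ)
  | cfg (f : ListBlank Γ → Prop)
  | final (p : Prop)
  | junk

/-- The action of a letter on the values of suffixes. A state turns the right half of the tape
into the set of those left halves with which the machine halts. -/
def act (M : TM0.Machine Γ Λ) : Letter Γ S → Suffix Γ → Suffix Γ
  | .right, .start => .tape (ListBlank.mk [])
  | .sym a, .tape R => .tape (R.cons a)
  | .state q, .tape R =>
    .cfg fun L => (StateTransition.eval (TM0.step M) ⟨q, Tape.mk' L R⟩).Dom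
  | .halted, .tape _ => .cfg fun _ => True
  | .sym a, .cfg f => .cfg fun L => f (L.cons a)
  | .left, .cfg f => .final (f (ListBlank.mk []))
  | _, _ => .junk

theorem mk_nil_cons_default : (ListBlank.mk [] : ListBlank Γ).cons default = ListBlank.mk [] := by
  ext i
  cases i <;> simp

theorem eval_dom_of_step {c c' : TM0.Cfg Γ Λ} (h : TM0.step M c = some c') :
    (StateTransition.eval (TM0.step M) c).Dom ↔ (StateTransition.eval (TM0.step M) c').Dom := by
  rw [StateTransition.reaches_eval (Relation.ReflTransGen.single h)]

/-- A machine step preserves and reflects halting because it is deterministic, the blank rules hold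
in `ListBlank`, and at a halting configuration the predicate is constantly true, which erasing
symbols does not change. -/
theorem Rule.foldr_act_eq {p q : List (Letter Γ S)} (h : Rule M S p q) (x : Suffix Γ) :
    p.foldr (act M) x = q.foldr (act M) x := by
  cases h with
  | write q q' a b h =>
    cases x <;> simp only [List.foldr, act]
    congr 1; funext L
    exact propext (eval_dom_of_step (by simp [TM0.step, h]))
  | moveRight q q' a h =>
    cases x <;> simp only [List.foldr, act]
    congr 1; funext L
    exact propext (eval_dom_of_step (by simp [TM0.step, h]))
  | moveLeft q q' a c h =>
    cases x <;> simp only [List.foldr, act]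
    congr 1; funext L
    exact propext (eval_dom_of_step (by simp [TM0.step, h]))
  | blankLeft => cases x <;> simp only [List.foldr, act, mk_nil_cons_default]
  | blankRight => cases x <;> simp only [List.foldr, act, mk_nil_cons_default]
  | halt q a h =>
    cases x <;> simp only [List.foldr, act]
    congr 1; funext L
    exact eq_true (Part.dom_iff_mem.2
      ⟨_, StateTransition.mem_eval.2 ⟨.refl, by simp [TM0.step, h]⟩⟩)
  | eraseLeft a => cases x <;> simp only [List.foldr, act]
  | eraseRight a => cases x <;> simp only [List.foldr, act]

/-- The word for the configuration with state `q`, left half `L` (read from the head) and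
right half `R` of the tape. -/
def word (L : List Γ) (q : Letter Γ S) (R : List Γ) : List (Letter Γ S) :=
  left :: (L.reverse.map sym ++ q :: (R.map sym ++ [right]))

/-- Evaluated from the right end, the first word has value `final` of the halting statement and the
second has value `final True`. -/
theorem eval_dom_of_thueEquiv {q : S} {R : List Γ}
    (h : ThueEquiv (Rule M S) (word [] (state q) R) (word [] halted [])) :
    (StateTransition.eval (TM0.step M)
      ⟨q, Tape.mk' (ListBlank.mk []) (ListBlank.mk R)⟩).Dom := by
  have tape : ∀ R : List Γ, (R.map (sym (S := S)) ++ [right]).foldr (act M) .start =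
      .tape (ListBlank.mk R) := by
    intro R
    induction R with
    | nil => rfl
    | cons a R ih => rw [List.map_cons, List.cons_append, List.foldr_cons, ih]; rfl
  have := ThueEquiv.foldr_eq (fun p q h => Rule.foldr_act_eq h) h .start
  simp only [word, List.reverse_nil, List.map_nil, List.nil_append, List.foldr_cons, tape] at this
  simpa [act] using this

theorem thueEquiv_word_blankLeft (q : Letter Γ S) (R : List Γ) :
    ThueEquiv (Rule M S) (word [] q R) (word [default] q R) :=
  .symm _ _ (ThueEquiv.of_rule [] (q :: (R.map sym ++ [right])) .blankLeft rfl rfl)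

theorem thueEquiv_word_blankRight (q : Letter Γ S) (L : List Γ) :
    ThueEquiv (Rule M S) (word L q []) (word L q [default]) :=
  .symm _ _ (ThueEquiv.of_rule (left :: (L.reverse.map sym ++ [q])) [] .blankRight
    (by simp [word]) (by simp [word]))

theorem thueEquiv_word_halted (L R : List Γ) :
    ThueEquiv (Rule M S) (word L halted R) (word [] halted []) := by
  induction L with
  | nil =>
    induction R with
    | nil => exact .refl _
    | cons a R ih =>
      exact .trans _ _ _ (ThueEquiv.of_rule [left] (R.map sym ++ [right]) (.eraseRight a) rfl rfl) ih
  | cons a L ih =>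
    exact .trans _ _ _ (ThueEquiv.of_rule (left :: L.reverse.map sym) (R.map sym ++ [right])
      (.eraseLeft a) (by simp [word]) (by simp [word])) ih

/-- Induction along the halting run, from its end; `L` and `R` are arbitrary lists representing the
half tapes, so blanks can be inserted when a rule needs a symbol. -/
theorem thueEquiv_of_eval_dom (hS : TM0.Supports M S) {q : S} {L R : List Γ}
    (h : (StateTransition.eval (TM0.step M)
      ⟨q, Tape.mk' (ListBlank.mk L) (ListBlank.mk R)⟩).Dom) :
    ThueEquiv (Rule M S) (word L (state q) R) (word [] halted []) := by
  obtain ⟨b, hmem⟩ := Part.dom_iff_mem.1 h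
  obtain ⟨hb, hnone⟩ := StateTransition.mem_eval.1 hmem
  clear h hmem
  generalize hc : (⟨q, Tape.mk' (ListBlank.mk L) (ListBlank.mk R)⟩ : TM0.Cfg Γ Λ) = c at hb
  induction hb using Relation.ReflTransGen.head_induction_on generalizing q L R with
  | refl =>
    subst hc
    -- A rule needs a scanned symbol; an empty `R` is first replaced by `[default]`.
    have key : ∀ a R', ListBlank.mk R = ListBlank.mk (a :: R') →
        ThueEquiv (Rule M S) (word L (state q) (a :: R')) (word [] halted []) := by
      intro a R' hR
      rw [hR] at hnone
      have hM : M q a = none := by simpa [TM0.step] using hnone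
      exact .trans _ _ _ (ThueEquiv.of_rule (left :: L.reverse.map sym) (R'.map sym ++ [right])
        (.halt q a hM) (by simp [word]) (by simp [word])) (thueEquiv_word_halted L R')
    cases R with
    | nil => exact .trans _ _ _ (thueEquiv_word_blankRight _ _) (key _ _ mk_nil_cons_default.symm)
    | cons a R' => exact key _ _ rfl
  | head hstep _ ih =>
    subst hc
    have key : ∀ a R', ListBlank.mk R = ListBlank.mk (a :: R') →
        ThueEquiv (Rule M S) (word L (state q) (a :: R')) (word [] halted []) := by
      intro a R' hR
      rw [hR] at hstep
      obtain ⟨⟨q₁, s⟩, hM, rfl⟩ := Option.map_eq_some_iff.1 hstep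
      replace hM : M q a = some (q₁, s) := by simpa using hM
      obtain ⟨q', rfl⟩ : ∃ q' : S, q'.1 = q₁ := ⟨⟨q₁, hS.2 hM q.2⟩, rfl⟩
      rcases s with (_ | _) | b
      -- A left move also needs a symbol to the left of the state.
      · have keyL : ∀ c L', ListBlank.mk L = ListBlank.mk (c :: L') →
            ThueEquiv (Rule M S) (word (c :: L') (state q) (a :: R')) (word [] halted []) := by
          intro c L' hL
          refine .trans _ _ _ (ThueEquiv.of_rule (left :: L'.reverse.map sym) (R'.map sym ++ [right])
            (.moveLeft q q' a c hM) (by simp [word]) ?_) (ih (q := q') (L := L')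
            (R := c :: a :: R') (by simp [hL]))
          simp [word]
        cases L with
        | nil =>
          exact .trans _ _ _ (thueEquiv_word_blankLeft _ _) (keyL _ _ mk_nil_cons_default.symm)
        | cons c L' => exact keyL _ _ rfl
      · refine .trans _ _ _ (ThueEquiv.of_rule (left :: L.reverse.map sym) (R'.map sym ++ [right])
          (.moveRight q q' a hM) (by simp [word]) ?_) (ih (q := q') (L := a :: L)
          (R := R') (by simp))
        simp [word]
      · refine .trans _ _ _ (ThueEquiv.of_rule (left :: L.reverse.map sym) (R'.map sym ++ [right])
          (.write q q' a b hM) (by simp [word]) ?_) (ih (q := q') (L := L)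
          (R := b :: R') (by simp))
        simp [word]
    cases R with
    | nil => exact .trans _ _ _ (thueEquiv_word_blankRight _ _) (key _ _ mk_nil_cons_default.symm)
    | cons a R' => exact key _ _ rfl

/-- Halting of a finite Turing machine is an equivalence of words. -/
theorem thueEquiv_iff_eval_dom (hS : TM0.Supports M S) (R : List Γ) :
    ThueEquiv (Rule M S) (word [] (state ⟨default, hS.1⟩) R) (word [] halted []) ↔
      (TM0.eval M R).Dom :=
  ⟨eval_dom_of_thueEquiv, fun h => thueEquiv_of_eval_dom hS h⟩

end TuringThue

/-! ### Turing machines for partial recursive functions -/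

theorem Primrec.two_pow : Primrec fun n : ℕ => 2 ^ n :=
  (Primrec.nat_rec₁ (f := fun _ y => 2 * y) 1
    (Primrec.nat_mul.comp (Primrec.const 2) Primrec.snd)).of_eq fun n => by
      induction n with
      | zero => rfl
      | succ n ih => simp only [ih, pow_succ']

namespace TuringThue

open Turing Turing.PartrecToTM2

/-- Binary digits are stored least significant first. Powers of two thus turn the binary input of
the machine into unary input. -/
theorem trNat_two_pow (n : ℕ) : trNat (2 ^ n) = List.replicate n Γ'.bit0 ++ [Γ'.bit1] := by
  have hnum : ∀ n : ℕ, ∃ p : PosNum, (p : ℕ) = 2 ^ n ∧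
      trPosNum p = List.replicate n Γ'.bit0 ++ [Γ'.bit1] := by
    intro n
    induction n with
    | zero => exact ⟨1, rfl, rfl⟩
    | succ n ih =>
      obtain ⟨p, hp, ht⟩ := ih
      exact ⟨p.bit0, by rw [PosNum.cast_bit0, hp]; ring, by
        rw [trPosNum, ht, List.replicate_succ]; rfl⟩
  obtain ⟨p, hp, ht⟩ := hnum n
  rw [← ht, trNat, ← hp, ← Num.cast_pos, Num.of_to_nat]
  rfl

/-- A partial recursive function can be precomposed with a partial inverse of `n ↦ 2 ^ n`. -/
theorem exists_partrec_two_pow {f : ℕ →. ℕ} (hf : Partrec f) :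
    ∃ g : ℕ →. ℕ, Partrec g ∧ ∀ n, g (2 ^ n) = f n := by
  let p : ℕ → ℕ →. Bool := fun x n => Part.some (decide (2 ^ n = x))
  refine ⟨fun x => (Nat.rfind (p x)).bind f, ?_, fun n => ?_⟩
  · have hdec : Computable₂ fun x n : ℕ => decide (2 ^ n = x) :=
      (Primrec.eq.decide.comp (Primrec.two_pow.comp Primrec.snd) Primrec.fst).to_comp
    have hp : Partrec₂ p := hdec.partrec₂
    exact (Partrec.rfind hp).bind (hf.comp Computable.snd)
  · have hmem : n ∈ Nat.rfind (p (2 ^ n)) := by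
      refine Nat.mem_rfind.2 ⟨by simp [p], fun {m} hm => ?_⟩
      have hne : 2 ^ m ≠ 2 ^ n := (Nat.pow_right_injective le_rfl).ne hm.ne
      simp only [p, decide_eq_false hne, Part.mem_some]
    change (Nat.rfind (p (2 ^ n))).bind f = f n
    rw [Part.eq_some_iff.2 hmem]
    exact Part.bind_some _ _

instance : Finite K' := by
  refine Finite.of_surjective (fun i : Fin 4 =>
    match i with | 0 => K'.main | 1 => K'.rev | 2 => K'.aux | 3 => K'.stack) ?_
  rintro (_ | _ | _ | _)
  exacts [⟨0, rfl⟩, ⟨1, rfl⟩, ⟨2, rfl⟩, ⟨3, rfl⟩]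

/-- Every domain of a partial recursive function is the halting set of a finite Turing machine
with unary input. -/
theorem exists_tm0_eval_dom_iff {f : ℕ →. ℕ} (hf : Partrec f) :
    ∃ (Γ Λ : Type) (_ : Inhabited Γ) (_ : Inhabited Λ) (_ : Finite Γ) (M : TM0.Machine Γ Λ)
      (S : Finset Λ) (a b c : Γ), TM0.Supports M S ∧
        ∀ n, (TM0.eval M (a :: b :: List.replicate n c)).Dom ↔ (f n).Dom := by
  obtain ⟨g, hg, hgf⟩ := exists_partrec_two_pow hf
  obtain ⟨c, hc⟩ := ToPartrec.Code.exists_code (Nat.Partrec'.part_iff₁.2 hg)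
  -- `TM2.init` starts in the default state, so the default has to be the entry point of the program
  -- for `c`.
  let _ : Inhabited Λ' := ⟨trNormal c Cont'.halt⟩
  refine ⟨TM2to1.Γ' K' fun _ => Γ', TM1to0.Λ' (TM2to1.tr tr), inferInstance, inferInstance,
    inferInstanceAs (Finite (Bool × (K' → Option Γ'))), TM1to0.tr (TM2to1.tr tr), TM1to0.trStmts (TM2to1.tr tr)
      (TM2to1.trSupp tr (codeSupp c Cont'.halt)),
    -- A tape cell holds one entry of each stack, and the Boolean marks the bottom. Only the main
    -- stack is filled initially; written from the bottom it is `cons`, `bit1` and then `n` times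
    -- `bit0`.
    (true, Function.update (fun _ => none) K'.main (some Γ'.cons)),
    (false, Function.update (fun _ => none) K'.main (some Γ'.bit1)),
    (false, Function.update (fun _ => none) K'.main (some Γ'.bit0)),
    TM1to0.tr_supports _ (TM2to1.tr_supports _ (tr_supports c Cont'.halt)), fun n => ?_⟩
  have hinit : (TM2.init K'.main (trList [2 ^ n]) : Cfg') = init c [2 ^ n] := by
    simp only [TM2.init, init]
    congr 1
    funext k
    cases k <;> rfl
  have heval : (TM2.eval tr K'.main (trList [2 ^ n])).Dom ↔ (f n).Dom := by
    have := hc (2 ^ n ::ᵥ List.Vector.nil)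
    rw [← hgf]
    change (StateTransition.eval (TM2.step tr) (TM2.init K'.main (trList [2 ^ n]))).Dom ↔ _
    rw [hinit, tr_eval]
    change (c.eval [2 ^ n]).Dom ↔ _
    rw [show c.eval [2 ^ n] = pure <$> g (2 ^ n) from this]
    exact Iff.rfl
  refine Iff.trans ?_ heval
  rw [TM1to0.tr_eval]
  refine Iff.trans (iff_of_eq (congrArg (fun l => (TM1.eval _ l).Dom) ?_))
    (TM2to1.tr_eval_dom (Γ := fun _ : K' => Γ') (Λ := Λ') (σ := Option Γ') tr K'.main
      (trList [2 ^ n]))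
  have hrev : (trList [2 ^ n]).reverse = Γ'.cons :: Γ'.bit1 :: List.replicate n Γ'.bit0 := by
    simp [trNat_two_pow]
  rw [TM2to1.trInit, hrev]
  exact congrArg _ (congrArg _ (List.map_replicate (f := fun a : Γ' =>
    ((false, Function.update (fun _ => none) K'.main (some a)) : Bool × (K' → Option Γ')))).symm)

end TuringThue

/-- The word problem for some Thue system, with a fixed right-hand word, is undecidable, even for
left-hand words of a simple form. -/
theorem exists_thueInstance_halting {f : ℕ →. ℕ} (hf : Partrec f) :
    ∃ (m : ℕ) (pre suf r : List (Fin m)) (c : Fin m) (rules : List (List (Fin m) × List (Fin m)))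
      (hl : ∀ n, pre ++ List.replicate n c ++ suf ≠ []) (hr : r ≠ [])
      (rules_ne : ∀ p ∈ rules, p.1 ≠ [] ∧ p.2 ≠ []),
      ∀ n, (DLLite.ThueInstance.mk m (pre ++ List.replicate n c ++ suf) r rules (hl n) hr
        rules_ne).Positive ↔ (f n).Dom := by
  obtain ⟨Γ, Λ, _, _, _, M, S, a, b, c, hS, hM⟩ := TuringThue.exists_tm0_eval_dom_iff hf
  obtain ⟨m, e, rules, rules_ne, h⟩ := exists_thueInstance_positive_iff
    (TuringThue.finite_rule (M := M) (S := S)) fun _ _ => TuringThue.Rule.ne_nil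
  refine ⟨m, [e .left, e (.state ⟨default, hS.1⟩), e (.sym a), e (.sym b)], [e .right],
    (TuringThue.word [] .halted []).map e, e (.sym c), rules, by simp,
    by simp [TuringThue.word], rules_ne, fun n => ?_⟩
  rw [← hM, ← TuringThue.thueEquiv_iff_eval_dom hS, ← h _ _ (by simp [TuringThue.word])
    (by simp [TuringThue.word])]
  simp [TuringThue.word]

/-! ### Computability of the reduction -/

namespace DLLite

theorem Atom.primrec_role : Primrec fun p : ℕ × ℕ × ℕ => Atom.role p.1 p.2.1 p.2.2 :=
  (Primrec.of_equiv_symm (e := Atom.equivSum)).comp (Primrec.sumInr.comp Primrec.sumInl)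

namespace ThueInstance

/-- Each atom becomes an explicit function of its position, which replaces a recursion with changing
variables by a primitive recursive `map`. The default `R₀` is never reached, since `i < w.length`.
-/
theorem path_eq_map_range {m : ℕ} (R₀ : Fin m) (w : List (Fin m)) (x y z : ℕ) :
    path x y z w = (List.range w.length).map fun i =>
      Atom.role (w.getD i R₀) (if i = 0 then x else z + i - 1)
        (if i + 1 = w.length then y else z + i) := by
  induction w generalizing x z with
  | nil => rfl
  | cons R w ih =>
    cases w with
    | nil => rfl
    | cons S w =>
      rw [path, ih, List.length_cons (a := R), List.range_succ_eq_map, List.map_cons,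
        List.map_map]
      congr 1
      refine List.map_congr_left fun i _ => ?_
      simp only [Function.comp, List.length_cons, List.getD_cons_succ, Nat.succ_eq_add_one]
      congr 1
      · rw [if_neg i.succ_ne_zero]
        split_ifs <;> omega
      · split_ifs <;> omega

theorem primrec_path {m : ℕ} (R₀ : Fin m) (x y : ℕ) {z : ℕ → ℕ} {w : ℕ → List (Fin m)}
    (hz : Primrec z) (hw : Primrec w) : Primrec fun n => path x y (z n) (w n) := by
  have hlen : Primrec fun p : ℕ × ℕ => (w p.1).length :=
    Primrec.list_length.comp (hw.comp Primrec.fst)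
  have hzi : Primrec fun p : ℕ × ℕ => z p.1 + p.2 :=
    Primrec.nat_add.comp (hz.comp Primrec.fst) Primrec.snd
  have hrole : Primrec₂ fun n i : ℕ => Atom.role ((w n).getD i R₀)
      (if i = 0 then x else z n + i - 1) (if i + 1 = (w n).length then y else z n + i) := by
    suffices h : Primrec fun p : ℕ × ℕ => (((w p.1).getD p.2 R₀ : ℕ),
        (if p.2 = 0 then x else z p.1 + p.2 - 1),
        (if p.2 + 1 = (w p.1).length then y else z p.1 + p.2)) from Atom.primrec_role.comp h
    refine .pair ?_ (.pair ?_ ?_)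
    · exact Primrec.fin_val.comp
        ((Primrec.list_getD R₀).comp (hw.comp Primrec.fst) Primrec.snd)
    · exact Primrec.ite (Primrec.eq.comp Primrec.snd (Primrec.const 0)) (Primrec.const x)
        (Primrec.nat_sub.comp hzi (Primrec.const 1))
    · exact Primrec.ite (Primrec.eq.comp (Primrec.succ.comp Primrec.snd) hlen)
        (Primrec.const y) hzi
  exact (Primrec.list_map (Primrec.list_range.comp (Primrec.list_length.comp hw)) hrole).of_eq
    fun n => (path_eq_map_range R₀ (w n) x y (z n)).symm

theorem primrec_diamond {T : ℕ → ThueInstance} {m : ℕ} {r : List (Fin m)}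
    {w : ℕ → List (Fin m)} (R₀ : Fin m) (hw : Primrec w)
    (hT : ∀ n, (T n).diamond = .concept 0 0 :: (path 0 1 2 (w n) ++
      path 0 1 (2 + (w n).length) r)) : Primrec fun n => (T n).diamond := by
  refine Primrec.of_eq ?_ fun n => (hT n).symm
  exact Primrec.list_cons.comp (Primrec.const _) (Primrec.list_append.comp
    (primrec_path R₀ 0 1 (Primrec.const 2) hw)
    (primrec_path R₀ 0 1 (Primrec.nat_add.comp (Primrec.const 2) (Primrec.list_length.comp hw))
      (Primrec.const r)))

end ThueInstance

/-! ### Undecidability of entailment -/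

theorem exists_computable_reduction {f : ℕ →. ℕ} (hf : Partrec f) :
    ∃ T : ℕ → ThueInstance, Computable (fun n => ((T n).ontology, (T n).query)) ∧
      ∀ n, (T n).Positive ↔ (f n).Dom := by
  obtain ⟨m, pre, suf, r, c, rules, hl, hr, rules_ne, h⟩ := exists_thueInstance_halting hf
  refine ⟨fun n => ⟨m, pre ++ List.replicate n c ++ suf, r, rules, hl n, hr, rules_ne⟩, ?_, h⟩
  have hrep : Primrec fun n => List.replicate n c :=
    (Primrec.list_map Primrec.list_range (Primrec.const c).to₂).of_eq fun n => by simp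
  have hw : Primrec fun n => pre ++ List.replicate n c ++ suf :=
    Primrec.list_append.comp (Primrec.list_append.comp (Primrec.const pre) hrep)
      (Primrec.const suf)
  have hdia := ThueInstance.primrec_diamond c hw (r := r)
    (T := fun n => ⟨m, pre ++ List.replicate n c ++ suf, r, rules, hl n, hr, rules_ne⟩)
    fun n => rfl
  -- The ontology and the detectors do not involve the left-hand word, so they are constants and `hl
  -- 0` may stand for every `hl n`.
  refine (Primrec.pair (Primrec.const (ThueInstance.ontology ⟨m, _, r, rules, hl 0, hr, rules_ne⟩))
    (Primrec.list_append.comp (Primrec.const (rules.map ThueInstance.detector))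
      (Primrec.list_cons.comp hdia (Primrec.const [])))).to_comp

theorem not_computablePred_of_positive_iff {P : Ontology × UCQ → Prop}
    (hP : ∀ T : ThueInstance, P (T.ontology, T.query) ↔ T.Positive) : ¬ ComputablePred P := by
  intro hcomp
  -- One partial recursive function, running the `n`-th code on input `0`, carries the whole halting
  -- problem.
  have hf : Partrec fun n : ℕ => (Denumerable.ofNat Nat.Partrec.Code n).eval 0 :=
    Nat.Partrec.Code.eval_part.comp (Computable.ofNat _) (Computable.const 0)
  obtain ⟨T, hT, hpos⟩ := exists_computable_reduction hf
  refine ComputablePred.halting_problem 0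
    (ComputablePred.computable_of_manyOneReducible ⟨fun c => _, hT.comp Computable.encode, ?_⟩
      hcomp)
  intro c
  rw [hP, hpos, Denumerable.ofNat_encode]

end DLLite

theorem theorem3 :
    (¬ ComputablePred fun p : DLLite.Ontology × DLLite.UCQ => DLLite.Entails p.1 p.2) ∧
    (¬ ComputablePred fun p : DLLite.Ontology × DLLite.UCQ => DLLite.EntailsUNA p.1 p.2) ∧
    ∀ T : DLLite.ThueInstance,
      (DLLite.Entails T.ontology T.query ↔ T.Positive) ∧
      (DLLite.EntailsUNA T.ontology T.query ↔ T.Positive) ∧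
      T.canonical.IsModel T.ontology ∧
      T.canonical.UniqueNames T.ontology ∧
      (¬ T.Positive → ¬ T.canonical.satUCQ T.query) :=
  ⟨DLLite.not_computablePred_of_positive_iff DLLite.ThueInstance.entails_iff,
    DLLite.not_computablePred_of_positive_iff DLLite.ThueInstance.entailsUNA_iff,
    fun T => ⟨T.entails_iff, T.entailsUNA_iff, T.canonical_isModel, T.canonical_uniqueNames,
      T.canonical_not_satUCQ⟩⟩
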